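/- Let $a_1,a_3\in\mathbb R^3$ be orthonormal vectors. For a unit vector $p$ and $\varphi\in\mathbb R$ let $R(p,\varphi)\in SO(3)$ be the rotation about the axis $p$ through the angle $\varphi$, and let $G_1=\mathcal E\cdot a_3$ be the skew-symmetric tensor with entries $(G_1)_{ij}=\sum_k\varepsilon_{ijk}(a_3)_k$, where $\varepsilon$ is the permutation (Levi-Civita) symbol. Consider the following subgroups of $O(3)$, given by generators, with $\gamma$ running through $[0,2\pi)$: $\mathcal C_\infty=\langle R(a_3,\gamma)\rangle$, $\mathcal C_{\infty h}=\langle -1,R(a_3,\gamma)\rangle$, $\mathcal C_{\infty v}=\langle R(a_3,\gamma),-R(a_1,\pi)\rangle$, $\mathcal D_{\infty h}=\langle -1,R(a_3,\gamma),R(a_1,\pi)\rangle$, $\mathcal K_h=O(3)$. Let $C$ denote a symmetric second order tensor (a real symmetric $3\times3$ matrix), identified with its six independent coordinates $x_1,\dots,x_6$. For a subgroup $\mathcal G\subseteq O(3)$, a polynomial $I\in\mathbb R[x_1,\dots,x_6]$ is called $\mathcal G$-invariant if $I(QCQ^\top)=I(C)$ for all $Q\in\mathcal G$ and all symmetric $C$.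 Homogeneous $\mathcal G$-invariant polynomials $I_1,\dots,I_m$ form an irreducible integrity basis of $\mathcal G$ if every $\mathcal G$-invariant polynomial has the form $f(I_1,\dots,I_m)$ with $f\in\mathbb R[y_1,\dots,y_m]$, and no $I_k$ is a real polynomial in the $I_j$ with $j\neq k$. Then: 1. For both $\mathcal C_\infty$ and $\mathcal C_{\infty h}$, the six polynomials $\operatorname{tr}C,\ \operatorname{tr}(C\cdot G_1^2),\ \operatorname{tr}C^2,\ \operatorname{tr}(C^2\cdot G_1^2),\ \operatorname{tr}C^3,\ \operatorname{tr}(C^2\cdot G_1^2\cdot C\cdot G_1)$ form an irreducible integrity basis. 2. For both $\mathcal C_{\infty v}$ and $\mathcal D_{\infty h}$, the five polynomials $\operatorname{tr}C,\ \operatorname{tr}(C\cdot a_3a_3^\top),\ \operatorname{tr}C^2,\ \operatorname{tr}(C^2\cdot a_3a_3^\top),\ \operatorname{tr}C^3$ form an irreducible integrity basis. 3. For $\mathcal K_h=O(3)$, the three polynomials $\operatorname{tr}C,\ \operatorname{tr}C^2,\ \operatorname{tr}C^3$ form an irreducible integrity basis. -/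

import Mathlib

open scoped Matrix

namespace IntegrityBases

/-- The group `O(3)` of orthogonal tensors, as real `3 × 3` matrices. -/
abbrev O3 : Type := Matrix.orthogonalGroup (Fin 3) ℝ

/-! ### Coordinates on symmetric tensors and invariant polynomials -/

/-- The six coordinates `(C₁₁, C₂₂, C₃₃, C₂₃, C₁₃, C₁₂)` of a symmetric second order tensor. -/
def coords {R : Type*} (S : Matrix (Fin 3) (Fin 3) R) : Fin 6 → R :=
  ![S 0 0, S 1 1, S 2 2, S 1 2, S 0 2, S 0 1]

/-- The polynomial ring `ℝ[x₁, …, x₆]` in the coordinates of a symmetric tensor. -/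
abbrev SymPoly : Type := MvPolynomial (Fin 6) ℝ

/-- The symmetric tensor `C` whose coordinates are the variables of `ℝ[x₁, …, x₆]`. -/
noncomputable def genC : Matrix (Fin 3) (Fin 3) SymPoly :=
  !![MvPolynomial.X 0, MvPolynomial.X 5, MvPolynomial.X 4;
     MvPolynomial.X 5, MvPolynomial.X 1, MvPolynomial.X 3;
     MvPolynomial.X 4, MvPolynomial.X 3, MvPolynomial.X 2]

theorem coords_genC : coords genC = MvPolynomial.X := by
  funext i
  fin_cases i <;> rfl

theorem genC_map_eval {S : Matrix (Fin 3) (Fin 3) ℝ} (hS : S.IsSymm) :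
    genC.map (MvPolynomial.eval (coords S)) = S := by
  have h : ∀ i j, S j i = S i j := fun i j => hS.apply i j
  ext i j
  fin_cases i <;> fin_cases j <;> simp [genC, coords, h 0 1, h 0 2, h 1 2]

/-- The ring `ℝ[x₁, …, x₆]^G` of the polynomials `I` in a symmetric tensor `C` with
`I(Q ⬝ C ⬝ Qᵀ) = I(C)` for all `Q ∈ G`. -/
def invariantRing (G : Subgroup O3) : Subalgebra ℝ SymPoly where
  carrier := {I | ∀ Q ∈ G, ∀ S : Matrix (Fin 3) (Fin 3) ℝ, S.IsSymm →
    MvPolynomial.eval (coords (Q.1 * S * Q.1ᵀ)) I = MvPolynomial.eval (coords S) I}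
  mul_mem' := by
    intro p q hp hq Q hQ S hS
    rw [map_mul, map_mul, hp Q hQ S hS, hq Q hQ S hS]
  add_mem' := by
    intro p q hp hq Q hQ S hS
    rw [map_add, map_add, hp Q hQ S hS, hq Q hQ S hS]
  algebraMap_mem' := by
    intro r Q _ S _
    simp [MvPolynomial.algebraMap_eq]

/-- Polynomial completeness: every `G`-invariant polynomial is a polynomial in the `I k`. -/
def PolynomiallyComplete (G : Subgroup O3) {m : ℕ} (I : Fin m → SymPoly) : Prop :=
  ∀ J ∈ invariantRing G, ∃ f : MvPolynomial (Fin m) ℝ, J = MvPolynomial.aeval I f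

/-- Polynomial irreducibility: no `I k` is a polynomial in the remaining ones. -/
def PolynomiallyIrreducible {m : ℕ} (I : Fin m → SymPoly) : Prop :=
  ¬ ∃ (k : Fin m) (g : MvPolynomial {j : Fin m // j ≠ k} ℝ),
    I k = MvPolynomial.aeval (fun j : {j : Fin m // j ≠ k} => I j.1) g

/-- A (finite) irreducible integrity basis of `G`: homogeneous `G`-invariant polynomials that are
polynomially complete and polynomially irreducible. -/
structure IsIrreducibleIntegrityBasis (G : Subgroup O3) {m : ℕ} (I : Fin m → SymPoly) : Prop where
  invariant : ∀ k, I k ∈ invariantRing G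
  homogeneous : ∀ k, ∃ d : ℕ, (I k).IsHomogeneous d
  complete : PolynomiallyComplete G I
  irreducible : PolynomiallyIrreducible I

/-! ### Structural tensors, rotations and point groups -/

/-- `E ⬝ a` for the permutation tensor `E`, i.e. the skew tensor with entries `∑ k, ε i j k * a k`. -/
def permContract (a : Fin 3 → ℝ) : Matrix (Fin 3) (Fin 3) ℝ :=
  !![0, a 2, -a 1;
     -a 2, 0, a 0;
     a 1, -a 0, 0]

theorem permContract_mulVec (a w : Fin 3 → ℝ) :
    permContract a *ᵥ w = crossProduct w a := by
  ext i
  fin_cases i <;>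
    simp [permContract, Matrix.mulVec, dotProduct, Fin.sum_univ_three, cross_apply] <;> ring

/-- The dyadic product `a a`. -/
def dyad (a : Fin 3 → ℝ) : Matrix (Fin 3) (Fin 3) ℝ := Matrix.vecMulVec a a

/-- The rotation about the axis of the unit vector `p` through the angle `φ` (Rodrigues' formula). -/
noncomputable def rot (p : Fin 3 → ℝ) (φ : ℝ) : Matrix (Fin 3) (Fin 3) ℝ :=
  Real.cos φ • (1 : Matrix (Fin 3) (Fin 3) ℝ) + (1 - Real.cos φ) • dyad p
    - Real.sin φ • permContract p

theorem rot_mulVec (p w : Fin 3 → ℝ) (φ : ℝ) :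
    rot p φ *ᵥ w = Real.cos φ • w + ((1 - Real.cos φ) * (p ⬝ᵥ w)) • p
      + Real.sin φ • crossProduct p w := by
  rw [rot, Matrix.sub_mulVec, Matrix.add_mulVec, Matrix.smul_mulVec, Matrix.smul_mulVec,
    Matrix.smul_mulVec, Matrix.one_mulVec, permContract_mulVec, dyad, Matrix.vecMulVec_mulVec]
  ext i
  have h : -(crossProduct p w i) = crossProduct w p i := congrFun (cross_anticomm p w) i
  simp only [Pi.add_apply, Pi.sub_apply, Pi.smul_apply, smul_eq_mul, MulOpposite.smul_eq_mul_unop,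
    MulOpposite.unop_op, ← h]
  ring

theorem rot_mem_orthogonalGroup {p : Fin 3 → ℝ} (hp : p ⬝ᵥ p = 1) (φ : ℝ) :
    rot p φ ∈ Matrix.orthogonalGroup (Fin 3) ℝ := by
  rw [Matrix.mem_orthogonalGroup_iff]
  have h1 : p 0 * p 0 + p 1 * p 1 + p 2 * p 2 = 1 := by
    simpa [dotProduct, Fin.sum_univ_three] using hp
  have h2 := Real.sin_sq_add_cos_sq φ
  generalize hx : p 0 = x at h1
  generalize hy : p 1 = y at h1
  generalize hz : p 2 = z at h1
  have key : dyad p = !![x * x, x * y, x * z; y * x, y * y, y * z; z * x, z * y, z * z] := by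
    subst hx hy hz
    ext i j
    fin_cases i <;> fin_cases j <;> simp [dyad, Matrix.vecMulVec_apply]
  rw [rot, key, permContract, hx, hy, hz]
  generalize Real.cos φ = c at h2
  generalize Real.sin φ = s at h2
  ext i j
  fin_cases i <;> fin_cases j <;>
    simp [Matrix.mul_apply, Fin.sum_univ_three, Matrix.one_apply] <;>
    grind

/-- The elements `R(p, γ)`, `γ ∈ [0, 2π)`, of `O(3)`. -/
def axialRotations (p : Fin 3 → ℝ) : Set O3 :=
  {Q | ∃ γ ∈ Set.Ico (0 : ℝ) (2 * Real.pi), Q.1 = rot p γ}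

/-- `C_∞`, generated by `R(z, γ)`. -/
def Cinf (z : Fin 3 → ℝ) : Subgroup O3 := Subgroup.closure (axialRotations z)

/-- `C_∞h`, generated by `-1` and `R(z, γ)`. -/
def CinfH (z : Fin 3 → ℝ) : Subgroup O3 :=
  Subgroup.closure (axialRotations z ∪ {Q | Q.1 = -1})

/-- `C_∞v`, generated by `R(z, γ)` and `-R(x, π)`. -/
def CinfV (x z : Fin 3 → ℝ) : Subgroup O3 :=
  Subgroup.closure (axialRotations z ∪ {Q | Q.1 = -rot x Real.pi})

/-- `D_∞h`, generated by `-1`, `R(z, γ)` and `R(x, π)`. -/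
def DinfH (x z : Fin 3 → ℝ) : Subgroup O3 :=
  Subgroup.closure (axialRotations z ∪ {Q | Q.1 = -1} ∪ {Q | Q.1 = rot x Real.pi})

/-- `K_h = O(3)`. -/
def Kh : Subgroup O3 := ⊤

/-! ### The listed invariants -/

/-- A constant tensor, regarded as a tensor with polynomial entries. -/
noncomputable def const (M : Matrix (Fin 3) (Fin 3) ℝ) : Matrix (Fin 3) (Fin 3) SymPoly :=
  M.map MvPolynomial.C

/-- With `G = E ⬝ a`: `tr C, tr(C G²), tr C², tr(C² G²), tr C³, tr(C² G² C G)`. -/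
noncomputable def basisCinf (a : Fin 3 → ℝ) : Fin 6 → SymPoly :=
  let G := const (permContract a)
  ![genC.trace, (genC * G ^ 2).trace, (genC ^ 2).trace, (genC ^ 2 * G ^ 2).trace,
    (genC ^ 3).trace, (genC ^ 2 * G ^ 2 * genC * G).trace]

/-- `tr C, tr(C aa), tr C², tr(C² aa), tr C³`. -/
noncomputable def basisDinf (a : Fin 3 → ℝ) : Fin 5 → SymPoly :=
  let A := const (dyad a)
  ![genC.trace, (genC * A).trace, (genC ^ 2).trace, (genC ^ 2 * A).trace, (genC ^ 3).trace]

/-- `tr C, tr C², tr C³`. -/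
noncomputable def basisKh : Fin 3 → SymPoly :=
  ![genC.trace, (genC ^ 2).trace, (genC ^ 3).trace]

end IntegrityBases

/-!
# Irreducible integrity bases of a symmetric tensor

Since `ℝ` is infinite, a polynomial in the coordinates of a symmetric tensor is determined by its
values at real symmetric tensors, so everything is checked on values
(`isIrreducibleIntegrityBasis_of_values`). The listed invariants are traces of products of the
tensor `S` and a structural tensor. Such traces do not change when both are conjugated by the same
orthogonal matrix; this gives invariance, and it allows passing to the frame `a₁, a₃ × a₁, a₃`.

*Groups with axis `a₃`.* In the complex coordinates `C₁₁ + C₂₂`, `C₃₃`, `z = C₁₃ + i C₂₃`,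
`w = C₁₁ - C₂₂ + 2 i C₁₂` and their conjugates, a rotation by `γ` about the axis multiplies `z` by
`exp(iγ)` and `w` by `exp(2iγ)`. Averaging an invariant over `γ` leaves only monomials of weight
zero, and these are products of `C₁₁ + C₂₂`, `C₃₃`, `z z̄`, `w w̄`, `z̄² w` and `z² w̄`
(`exists_eval_rotInv`). Taking real parts, the invariants of the rotations are the polynomials in
`C₁₁ + C₂₂`, `C₃₃`, `|z|²`, `|w|²`, `Re (z̄² w)`, `Im (z̄² w)`. A half-turn about `a₁` changes the
sign of the last of these only, and its square is a polynomial in the others, so it drops out when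
the half-turn is present (`exists_eval_rotInv_of_flip`). The listed traces are related to these
generators by a change of variables that is polynomial in both directions (`valC_std`,
`exists_valC_of_rotInv`, `valD_std`, `exists_valD_of_rotInv`). The inversion `-1` acts trivially on
second order tensors, hence each list serves two groups.

*The group `O(3)`.* By the spectral theorem an invariant is determined by its restriction to
diagonal tensors. This restriction is a symmetric polynomial, hence a polynomial in the power sums
of the eigenvalues (`exists_eval_valK`).

*Irreducibility.* If one invariant were a polynomial in the others, it would agree at any two
tensors at which all the others agree. Explicit pairs of tensors with integer entries exclude this
(`exists_valC_separated`, `exists_valD_separated`, `exists_valK_separated`).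
-/

namespace IntegrityBases

open MvPolynomial

/-! ### Tensors, their coordinates, and a pointwise criterion -/

/-- The symmetric tensor with given coordinates; a right inverse of `coords`. -/
def symOf {R : Type*} (x : Fin 6 → R) : Matrix (Fin 3) (Fin 3) R :=
  !![x 0, x 5, x 4; x 5, x 1, x 3; x 4, x 3, x 2]

theorem coords_symOf {R : Type*} (x : Fin 6 → R) : coords (symOf x) = x := by
  funext i
  fin_cases i <;> rfl

theorem isSymm_symOf {R : Type*} (x : Fin 6 → R) : (symOf x).IsSymm := by
  refine Matrix.IsSymm.ext fun i j => ?_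
  fin_cases i <;> fin_cases j <;> rfl

theorem symOf_coords {R : Type*} {S : Matrix (Fin 3) (Fin 3) R} (hS : S.IsSymm) :
    symOf (coords S) = S := by
  have h : ∀ i j, S j i = S i j := fun i j => hS.apply i j
  ext i j
  fin_cases i <;> fin_cases j <;> simp [symOf, coords, h 0 1, h 0 2, h 1 2]

/-- A symmetric tensor stays symmetric under `S ↦ P S Pᵀ`. -/
theorem isSymm_conj {R : Type*} [CommRing R] (P : Matrix (Fin 3) (Fin 3) R)
    {S : Matrix (Fin 3) (Fin 3) R} (hS : S.IsSymm) : (P * S * Pᵀ).IsSymm := by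
  rw [Matrix.IsSymm, Matrix.transpose_mul, Matrix.transpose_mul, Matrix.transpose_transpose,
    hS.eq, Matrix.mul_assoc]

theorem eval_aeval {σ τ : Type*} (x : τ → ℝ) (h : σ → MvPolynomial τ ℝ) (f : MvPolynomial σ ℝ) :
    eval x (aeval h f) = eval (fun i => eval x (h i)) f := by
  rw [aeval_def, algebraMap_eq, ← coe_eval₂Hom, ← RingHom.comp_apply]
  congr 1
  refine ringHom_ext (fun r => ?_) fun i => ?_ <;> simp

/-- Since `ℝ` is infinite, being an irreducible integrity basis can be checked on the values `v S`
of the polynomials at real symmetric tensors. Irreducibility is certified by two tensors at which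
all the polynomials but one agree. -/
theorem isIrreducibleIntegrityBasis_of_values {G : Subgroup O3} {m : ℕ} {I : Fin m → SymPoly}
    (v : Matrix (Fin 3) (Fin 3) ℝ → Fin m → ℝ)
    (hv : ∀ S : Matrix (Fin 3) (Fin 3) ℝ, S.IsSymm → ∀ k, eval (coords S) (I k) = v S k)
    (hhom : ∀ k, ∃ d : ℕ, (I k).IsHomogeneous d)
    (hinv : ∀ Q ∈ G, ∀ S : Matrix (Fin 3) (Fin 3) ℝ, S.IsSymm → v (Q.1 * S * Q.1ᵀ) = v S)
    (hcomp : ∀ J ∈ invariantRing G, ∃ f : MvPolynomial (Fin m) ℝ,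
      ∀ S : Matrix (Fin 3) (Fin 3) ℝ, S.IsSymm → eval (coords S) J = eval (v S) f)
    (hirr : ∀ k, ∃ S T : Matrix (Fin 3) (Fin 3) ℝ, S.IsSymm ∧ T.IsSymm ∧
      (∀ j, j ≠ k → v S j = v T j) ∧ v S k ≠ v T k) :
    IsIrreducibleIntegrityBasis G I where
  invariant k Q hQ S hS := by
    rw [hv _ (isSymm_conj _ hS), hv _ hS, hinv Q hQ S hS]
  homogeneous := hhom
  complete J hJ := by
    obtain ⟨f, hf⟩ := hcomp J hJ
    refine ⟨f, MvPolynomial.funext fun x => ?_⟩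
    have hx := hf (symOf x) (isSymm_symOf x)
    rw [coords_symOf] at hx
    have h2 : v (symOf x) = fun k => eval x (I k) := by
      funext k
      rw [← hv _ (isSymm_symOf x), coords_symOf]
    rw [hx, h2, eval_aeval]
  irreducible := by
    rintro ⟨k, g, hg⟩
    obtain ⟨S, T, hS, hT, hST, hne⟩ := hirr k
    refine hne ?_
    have key : ∀ U : Matrix (Fin 3) (Fin 3) ℝ, U.IsSymm →
        v U k = eval (fun j : {j : Fin m // j ≠ k} => v U j.1) g := by
      intro U hU
      rw [← hv U hU, hg, eval_aeval]
      simp only [hv U hU]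
    rw [key S hS, key T hT]
    congr 2
    funext j
    exact hST j.1 j.2

/-! ### Homogeneity -/

/-- All entries of a polynomial matrix are homogeneous of degree `d`. -/
def HomEntries (M : Matrix (Fin 3) (Fin 3) SymPoly) (d : ℕ) : Prop :=
  ∀ i j, (M i j).IsHomogeneous d

theorem HomEntries.mul {M N : Matrix (Fin 3) (Fin 3) SymPoly} {d e : ℕ} (hM : HomEntries M d)
    (hN : HomEntries N e) : HomEntries (M * N) (d + e) := by
  intro i j
  rw [Matrix.mul_apply]
  exact IsHomogeneous.sum _ _ _ fun k _ => (hM i k).mul (hN k j)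

theorem HomEntries.trace {M : Matrix (Fin 3) (Fin 3) SymPoly} {d : ℕ} (hM : HomEntries M d) :
    M.trace.IsHomogeneous d :=
  IsHomogeneous.sum _ _ _ fun k _ => hM k k

theorem homEntries_genC : HomEntries genC 1 := by
  intro i j
  fin_cases i <;> fin_cases j <;> exact isHomogeneous_X _ _

theorem homEntries_const (M : Matrix (Fin 3) (Fin 3) ℝ) : HomEntries (const M) 0 :=
  fun _ _ => isHomogeneous_C _ _

theorem homEntries_one : HomEntries 1 0 := by
  intro i j
  rw [Matrix.one_apply]
  split
  · exact isHomogeneous_one _ _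
  · exact isHomogeneous_zero _ _ _

theorem HomEntries.pow {M : Matrix (Fin 3) (Fin 3) SymPoly} {d : ℕ} (hM : HomEntries M d)
    (n : ℕ) : HomEntries (M ^ n) (n * d) := by
  induction n with
  | zero => simpa using homEntries_one
  | succ n ih => simpa [pow_succ, Nat.succ_mul] using ih.mul hM

theorem basisCinf_homogeneous (a : Fin 3 → ℝ) (k : Fin 6) :
    ∃ d : ℕ, (basisCinf a k).IsHomogeneous d := by
  have hC := homEntries_genC
  have hG := homEntries_const (permContract a)
  fin_cases k
  exacts [⟨_, hC.trace⟩, ⟨_, (hC.mul (hG.pow 2)).trace⟩, ⟨_, (hC.pow 2).trace⟩,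
    ⟨_, ((hC.pow 2).mul (hG.pow 2)).trace⟩, ⟨_, (hC.pow 3).trace⟩,
    ⟨_, ((((hC.pow 2).mul (hG.pow 2)).mul hC).mul hG).trace⟩]

theorem basisDinf_homogeneous (a : Fin 3 → ℝ) (k : Fin 5) :
    ∃ d : ℕ, (basisDinf a k).IsHomogeneous d := by
  have hC := homEntries_genC
  have hA := homEntries_const (dyad a)
  fin_cases k
  exacts [⟨_, hC.trace⟩, ⟨_, (hC.mul hA).trace⟩, ⟨_, (hC.pow 2).trace⟩,
    ⟨_, ((hC.pow 2).mul hA).trace⟩, ⟨_, (hC.pow 3).trace⟩]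

theorem basisKh_homogeneous (k : Fin 3) : ∃ d : ℕ, (basisKh k).IsHomogeneous d := by
  have hC := homEntries_genC
  fin_cases k
  exacts [⟨_, hC.trace⟩, ⟨_, (hC.pow 2).trace⟩, ⟨_, (hC.pow 3).trace⟩]

/-! ### Values of the listed invariants -/

/-- The values `tr S, tr(S G²), tr S², tr(S² G²), tr S³, tr(S² G² S G)`. -/
def valC (G S : Matrix (Fin 3) (Fin 3) ℝ) : Fin 6 → ℝ :=
  ![S.trace, (S * G ^ 2).trace, (S ^ 2).trace, (S ^ 2 * G ^ 2).trace, (S ^ 3).trace,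
    (S ^ 2 * G ^ 2 * S * G).trace]

/-- The values `tr S, tr(S A), tr S², tr(S² A), tr S³`. -/
def valD (A S : Matrix (Fin 3) (Fin 3) ℝ) : Fin 5 → ℝ :=
  ![S.trace, (S * A).trace, (S ^ 2).trace, (S ^ 2 * A).trace, (S ^ 3).trace]

/-- The values `tr S, tr S², tr S³`. -/
def valK (S : Matrix (Fin 3) (Fin 3) ℝ) : Fin 3 → ℝ :=
  ![S.trace, (S ^ 2).trace, (S ^ 3).trace]

theorem const_map_eval (x : Fin 6 → ℝ) (M : Matrix (Fin 3) (Fin 3) ℝ) :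
    (const M).map (eval x) = M := by
  ext i j
  simp [const]

theorem eval_trace (x : Fin 6 → ℝ) (M : Matrix (Fin 3) (Fin 3) SymPoly) :
    eval x M.trace = (M.map (eval x)).trace := by
  simp [Matrix.trace]

theorem map_eval_pow (x : Fin 6 → ℝ) (M : Matrix (Fin 3) (Fin 3) SymPoly) (n : ℕ) :
    (M ^ n).map (eval x) = M.map (eval x) ^ n :=
  map_pow (eval x).mapMatrix M n

theorem eval_basisCinf (a : Fin 3 → ℝ) {S : Matrix (Fin 3) (Fin 3) ℝ} (hS : S.IsSymm)
    (k : Fin 6) : eval (coords S) (basisCinf a k) = valC (permContract a) S k := by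
  fin_cases k <;>
    simp [basisCinf, valC, eval_trace, Matrix.map_mul, map_eval_pow, genC_map_eval hS,
      const_map_eval]

theorem eval_basisDinf (a : Fin 3 → ℝ) {S : Matrix (Fin 3) (Fin 3) ℝ} (hS : S.IsSymm)
    (k : Fin 5) : eval (coords S) (basisDinf a k) = valD (dyad a) S k := by
  fin_cases k <;>
    simp [basisDinf, valD, eval_trace, Matrix.map_mul, map_eval_pow, genC_map_eval hS,
      const_map_eval]

theorem eval_basisKh {S : Matrix (Fin 3) (Fin 3) ℝ} (hS : S.IsSymm) (k : Fin 3) :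
    eval (coords S) (basisKh k) = valK S k := by
  fin_cases k <;> simp [basisKh, valK, eval_trace, map_eval_pow, genC_map_eval hS]

section Conjugation

variable {P : Matrix (Fin 3) (Fin 3) ℝ}

theorem conj_mul_conj (hP : Pᵀ * P = 1) (X Y : Matrix (Fin 3) (Fin 3) ℝ) :
    P * X * Pᵀ * (P * Y * Pᵀ) = P * (X * Y) * Pᵀ := by
  calc P * X * Pᵀ * (P * Y * Pᵀ) = P * X * (Pᵀ * P) * Y * Pᵀ := by
        simp only [Matrix.mul_assoc]
    _ = P * (X * Y) * Pᵀ := by rw [hP, Matrix.mul_one, Matrix.mul_assoc P X Y]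

theorem conj_sq (hP : Pᵀ * P = 1) (X : Matrix (Fin 3) (Fin 3) ℝ) :
    (P * X * Pᵀ) ^ 2 = P * X ^ 2 * Pᵀ := by
  rw [pow_two, conj_mul_conj hP, ← pow_two]

theorem conj_cube (hP : Pᵀ * P = 1) (X : Matrix (Fin 3) (Fin 3) ℝ) :
    (P * X * Pᵀ) ^ 3 = P * X ^ 3 * Pᵀ := by
  rw [pow_succ, conj_sq hP, conj_mul_conj hP, ← pow_succ]

theorem trace_conj (hP : Pᵀ * P = 1) (X : Matrix (Fin 3) (Fin 3) ℝ) :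
    (P * X * Pᵀ).trace = X.trace := by
  rw [Matrix.mul_assoc, Matrix.trace_mul_comm, Matrix.mul_assoc, hP, Matrix.mul_one]

theorem valC_conj (hP : Pᵀ * P = 1) (G S : Matrix (Fin 3) (Fin 3) ℝ) :
    valC (P * G * Pᵀ) (P * S * Pᵀ) = valC G S := by
  simp only [valC, conj_sq hP, conj_cube hP, conj_mul_conj hP, trace_conj hP]

theorem valD_conj (hP : Pᵀ * P = 1) (A S : Matrix (Fin 3) (Fin 3) ℝ) :
    valD (P * A * Pᵀ) (P * S * Pᵀ) = valD A S := by
  simp only [valD, conj_sq hP, conj_cube hP, conj_mul_conj hP, trace_conj hP]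

theorem valK_conj (hP : Pᵀ * P = 1) (S : Matrix (Fin 3) (Fin 3) ℝ) :
    valK (P * S * Pᵀ) = valK S := by
  simp only [valK, conj_sq hP, conj_cube hP, trace_conj hP]

end Conjugation

theorem O3.transpose_mul_self (Q : O3) : Q.1ᵀ * Q.1 = 1 :=
  (Matrix.mem_orthogonalGroup_iff' (Fin 3) ℝ).1 Q.2

theorem O3.mul_transpose_self (Q : O3) : Q.1 * Q.1ᵀ = 1 :=
  (Matrix.mem_orthogonalGroup_iff (Fin 3) ℝ).1 Q.2

/-- The orthogonal tensors that leave the structural tensor `M` unchanged. -/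
def tensorStabilizer (M : Matrix (Fin 3) (Fin 3) ℝ) : Subgroup O3 where
  carrier := {Q | Q.1 * M * Q.1ᵀ = M}
  one_mem' := by simp
  mul_mem' := by
    intro Q R hQ hR
    change Q.1 * M * Q.1ᵀ = M at hQ
    change R.1 * M * R.1ᵀ = M at hR
    change (Q.1 * R.1) * M * (Q.1 * R.1)ᵀ = M
    rw [Matrix.transpose_mul]
    calc Q.1 * R.1 * M * (R.1ᵀ * Q.1ᵀ) = Q.1 * (R.1 * M * R.1ᵀ) * Q.1ᵀ := by
          simp only [Matrix.mul_assoc]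
      _ = M := by rw [hR, hQ]
  inv_mem' := by
    intro Q hQ
    change Q.1 * M * Q.1ᵀ = M at hQ
    change (Q⁻¹ : O3).1 * M * (Q⁻¹ : O3).1ᵀ = M
    have h : (Q⁻¹ : O3).1 = Q.1ᵀ := rfl
    rw [h, Matrix.transpose_transpose]
    calc Q.1ᵀ * M * Q.1 = Q.1ᵀ * (Q.1 * M * Q.1ᵀ) * Q.1 := by rw [hQ]
      _ = (Q.1ᵀ * Q.1) * M * (Q.1ᵀ * Q.1) := by simp only [Matrix.mul_assoc]
      _ = M := by rw [O3.transpose_mul_self, Matrix.one_mul, Matrix.mul_one]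

theorem mem_tensorStabilizer {M : Matrix (Fin 3) (Fin 3) ℝ} {Q : O3} :
    Q ∈ tensorStabilizer M ↔ Q.1 * M * Q.1ᵀ = M := Iff.rfl

/-! ### Invariants of the rotations about the third axis -/

/-- The action on coordinates of the rotation about the third axis with angle `γ`. -/
noncomputable def rotCoords (γ : ℝ) (x : Fin 6 → ℝ) : Fin 6 → ℝ :=
  let c := Real.cos γ
  let s := Real.sin γ
  ![c ^ 2 * x 0 - 2 * c * s * x 5 + s ^ 2 * x 1, s ^ 2 * x 0 + 2 * c * s * x 5 + c ^ 2 * x 1,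
    x 2, s * x 4 + c * x 3, c * x 4 - s * x 3, c * s * (x 0 - x 1) + (c ^ 2 - s ^ 2) * x 5]

/-- Complex coordinates `(C₁₁ + C₂₂, C₃₃, z, z̄, w, w̄)` that diagonalize the rotations about the
third axis, where `z = C₁₃ + i C₂₃` and `w = C₁₁ - C₂₂ + 2 i C₁₂`. -/
noncomputable def cplx (x : Fin 6 → ℝ) : Fin 6 → ℂ :=
  ![x 0 + x 1, x 2, x 4 + x 3 * Complex.I, x 4 - x 3 * Complex.I,
    x 0 - x 1 + 2 * x 5 * Complex.I, x 0 - x 1 - 2 * x 5 * Complex.I]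

/-- The weights of the complex coordinates `cplx` under rotations about the third axis. -/
def wt : Fin 6 → ℤ := ![0, 0, 1, -1, 2, -2]

/-- The rotation invariants `C₁₁ + C₂₂, C₃₃, |z|², |w|², Re (z̄² w), Im (z̄² w)`. -/
def rotInv (x : Fin 6 → ℝ) : Fin 6 → ℝ :=
  ![x 0 + x 1, x 2, x 4 ^ 2 + x 3 ^ 2, (x 0 - x 1) ^ 2 + 4 * x 5 ^ 2,
    (x 4 ^ 2 - x 3 ^ 2) * (x 0 - x 1) + 4 * x 3 * x 4 * x 5,
    2 * x 5 * (x 4 ^ 2 - x 3 ^ 2) - 2 * x 3 * x 4 * (x 0 - x 1)]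

theorem cplx_rotCoords (γ : ℝ) (x : Fin 6 → ℝ) (i : Fin 6) :
    cplx (rotCoords γ x) i = Complex.exp (γ * Complex.I) ^ wt i * cplx x i := by
  have hE : Complex.exp (γ * Complex.I) = Real.cos γ + Real.sin γ * Complex.I := by
    rw [Complex.exp_mul_I, Complex.ofReal_cos, Complex.ofReal_sin]
  have hE' : (Complex.exp (γ * Complex.I))⁻¹ = Real.cos γ - Real.sin γ * Complex.I := by
    rw [← Complex.exp_neg, ← neg_mul, Complex.exp_mul_I, Complex.cos_neg, Complex.sin_neg,
      Complex.ofReal_cos, Complex.ofReal_sin]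
    ring
  have hcs : (Real.cos γ : ℂ) ^ 2 + (Real.sin γ : ℂ) ^ 2 = 1 := by
    rw [Complex.ofReal_cos, Complex.ofReal_sin, Complex.cos_sq_add_sin_sq]
  have hI := Complex.I_sq
  have h2 : wt 4 = ((2 : ℕ) : ℤ) := rfl
  have h3 : wt 5 = -((2 : ℕ) : ℤ) := rfl
  have h4 : wt 3 = -1 := rfl
  have h5 : wt 2 = 1 := rfl
  have h0 : wt 0 = 0 := rfl
  have h1 : wt 1 = 0 := rfl
  fin_cases i
  · simp [cplx, rotCoords, h0]
    rw [Complex.ofReal_cos, Complex.ofReal_sin] at hcs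
    linear_combination ((x 0 : ℂ) + x 1) * hcs
  · simp [cplx, rotCoords, h1]
  · change _ = _ ^ wt 2 * _
    rw [h5, zpow_one, hE]
    simp [cplx, rotCoords]
    linear_combination -(Complex.sin γ * x 3) * hI
  · change _ = _ ^ wt 3 * _
    rw [h4, zpow_neg_one, hE']
    simp [cplx, rotCoords]
    linear_combination -(Complex.sin γ * x 3) * hI
  · change _ = _ ^ wt 4 * _
    rw [h2, zpow_natCast, hE]
    simp [cplx, rotCoords]
    linear_combination (-(Complex.sin γ ^ 2) * (x 0 - x 1 + 2 * x 5 * Complex.I)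
      - 4 * Complex.cos γ * Complex.sin γ * x 5) * hI
  · change _ = _ ^ wt 5 * _
    rw [h3, zpow_neg, zpow_natCast, ← inv_pow, hE']
    simp [cplx, rotCoords]
    linear_combination (-(Complex.sin γ ^ 2) * (x 0 - x 1 - 2 * x 5 * Complex.I)
      - 4 * Complex.cos γ * Complex.sin γ * x 5) * hI

/-- Every real polynomial in the coordinates is a complex polynomial in the diagonalizing ones. -/
theorem exists_eval_cplx (J : SymPoly) :
    ∃ p : MvPolynomial (Fin 6) ℂ, ∀ x, ((eval x J : ℝ) : ℂ) = eval (cplx x) p := by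
  induction J using MvPolynomial.induction_on with
  | C a => exact ⟨C (a : ℂ), fun x => by simp⟩
  | add p q hp hq =>
    obtain ⟨p', hp'⟩ := hp
    obtain ⟨q', hq'⟩ := hq
    exact ⟨p' + q', fun x => by simp [hp', hq']⟩
  | mul_X p i hp =>
    obtain ⟨p', hp'⟩ := hp
    suffices h : ∃ l : MvPolynomial (Fin 6) ℂ, ∀ x : Fin 6 → ℝ, (x i : ℂ) = eval (cplx x) l by
      obtain ⟨l, hl⟩ := h
      exact ⟨p' * l, fun x => by simp [hp', ← hl]⟩
    have hI := Complex.I_sq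
    fin_cases i
    · exact ⟨C (1 / 2) * X 0 + C (1 / 4) * (X 4 + X 5), fun x => by simp [cplx]; ring⟩
    · exact ⟨C (1 / 2) * X 0 - C (1 / 4) * (X 4 + X 5), fun x => by simp [cplx]; ring⟩
    · exact ⟨X 1, fun x => by simp [cplx]⟩
    · exact ⟨C (-Complex.I / 2) * (X 2 - X 3), fun x => by
        simp [cplx]; linear_combination (x 3 : ℂ) * hI⟩
    · exact ⟨C (1 / 2) * (X 2 + X 3), fun x => by simp [cplx]; ring⟩
    · exact ⟨C (-Complex.I / 4) * (X 4 - X 5), fun x => by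
        simp [cplx]; linear_combination (x 5 : ℂ) * hI⟩

theorem integral_exp_int (k : ℤ) :
    (∫ γ in (0 : ℝ)..2 * Real.pi, Complex.exp (γ * Complex.I) ^ k) =
      if k = 0 then 2 * (Real.pi : ℂ) else 0 := by
  split_ifs with h
  · simp [h]
  · have hk : (k : ℂ) * Complex.I ≠ 0 := by simp [h]
    have h1 : ∀ γ : ℝ, Complex.exp (γ * Complex.I) ^ k = Complex.exp (k * Complex.I * γ) := by
      intro γ
      rw [← Complex.exp_int_mul]
      congr 1
      ring
    simp_rw [h1]
    have h2 : Complex.exp (k * Complex.I * ((2 * Real.pi : ℝ) : ℂ)) = 1 := by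
      rw [Complex.exp_eq_one_iff]
      exact ⟨k, by push_cast; ring⟩
    rw [integral_exp_mul_complex hk, h2]
    simp

/-- Averaging over all rotations keeps exactly the monomials of weight zero. -/
theorem eval_eq_sum_weight_zero {J : SymPoly} {p : MvPolynomial (Fin 6) ℂ}
    (hJ : ∀ γ x, eval (rotCoords γ x) J = eval x J)
    (hp : ∀ x, ((eval x J : ℝ) : ℂ) = eval (cplx x) p) (x : Fin 6 → ℝ) :
    ((eval x J : ℝ) : ℂ) = ∑ m ∈ p.support with ∑ i, wt i * m i = 0,
      p.coeff m * ∏ i, cplx x i ^ m i := by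
  have hπ : (2 * (Real.pi : ℂ)) ≠ 0 := by simp [Real.pi_ne_zero]
  have key : ∀ γ : ℝ, ((eval x J : ℝ) : ℂ) = ∑ m ∈ p.support,
      Complex.exp (γ * Complex.I) ^ (∑ i, wt i * m i) *
        (p.coeff m * ∏ i, cplx x i ^ m i) := by
    intro γ
    rw [← hJ γ, hp, eval_eq']
    refine Finset.sum_congr rfl fun m _ => ?_
    have h1 : ∏ i, cplx (rotCoords γ x) i ^ m i =
        Complex.exp (γ * Complex.I) ^ (∑ i, wt i * m i) * ∏ i, cplx x i ^ m i := by
      have h2 : Complex.exp (γ * Complex.I) ^ (∑ i, wt i * m i) =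
          ∏ i, (Complex.exp (γ * Complex.I) ^ wt i) ^ m i := by
        simp only [Fin.sum_univ_six, Fin.prod_univ_six, ← zpow_natCast, ← zpow_mul,
          zpow_add₀ (Complex.exp_ne_zero _)]
      rw [h2, ← Finset.prod_mul_distrib]
      exact Finset.prod_congr rfl fun i _ => by rw [cplx_rotCoords, mul_pow]
    rw [h1]
    ring
  have hcont : ∀ k : ℤ, Continuous fun γ : ℝ => Complex.exp (γ * Complex.I) ^ k := fun k =>
    Continuous.zpow₀ (by fun_prop) k fun γ => Or.inl (Complex.exp_ne_zero _)
  have hii : ∀ m : Fin 6 →₀ ℕ, IntervalIntegrable (fun γ : ℝ =>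
      Complex.exp (γ * Complex.I) ^ (∑ i, wt i * m i) * (p.coeff m * ∏ i, cplx x i ^ m i))
      MeasureTheory.volume 0 (2 * Real.pi) := fun m =>
    ((hcont _).mul continuous_const).intervalIntegrable _ _
  have hint : (∫ _γ in (0 : ℝ)..2 * Real.pi, ((eval x J : ℝ) : ℂ)) =
      ∑ m ∈ p.support, (if (∑ i, wt i * m i) = 0 then 2 * (Real.pi : ℂ) else 0) *
        (p.coeff m * ∏ i, cplx x i ^ m i) := by
    rw [intervalIntegral.integral_congr fun γ _ => key γ,
      intervalIntegral.integral_finsetSum fun m _ => hii m]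
    refine Finset.sum_congr rfl fun m _ => ?_
    rw [intervalIntegral.integral_mul_const, integral_exp_int]
  rw [intervalIntegral.integral_const] at hint
  refine mul_left_cancel₀ hπ ?_
  rw [Finset.mul_sum, Finset.sum_filter]
  simp only [ite_mul, zero_mul] at hint
  rw [← hint]
  simp

/-- A monomial of weight zero is a polynomial in the rotation invariants: it is, up to powers of
`C₁₁ + C₂₂` and `C₃₃`, a product of powers of `z z̄`, `w w̄` and one of `z̄² w`, `z² w̄`. -/
theorem exists_eval_rotInv_monomial (m : Fin 6 → ℕ) (hm : ∑ i, wt i * m i = 0) :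
    ∃ f : MvPolynomial (Fin 6) ℂ, ∀ x, ∏ i, cplx x i ^ m i =
      eval (fun i => ((rotInv x i : ℝ) : ℂ)) f := by
  have hI := Complex.I_sq
  have hz : ∀ x, cplx x 2 * cplx x 3 = rotInv x 2 := fun x => by
    simp [cplx, rotInv]; linear_combination -(x 3 : ℂ) ^ 2 * hI
  have hw : ∀ x, cplx x 4 * cplx x 5 = rotInv x 3 := fun x => by
    simp [cplx, rotInv]; linear_combination -4 * (x 5 : ℂ) ^ 2 * hI
  have hzw : ∀ x, cplx x 3 ^ 2 * cplx x 4 = rotInv x 4 + rotInv x 5 * Complex.I := fun x => by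
    simp [cplx, rotInv]
    linear_combination ((x 3 : ℂ) ^ 2 * (x 0 - x 1 + 2 * x 5 * Complex.I) -
      4 * x 4 * x 3 * x 5) * hI
  have hzw' : ∀ x, cplx x 2 ^ 2 * cplx x 5 = rotInv x 4 - rotInv x 5 * Complex.I := fun x => by
    simp [cplx, rotInv]
    linear_combination ((x 3 : ℂ) ^ 2 * (x 0 - x 1 - 2 * x 5 * Complex.I) -
      4 * x 4 * x 3 * x 5) * hI
  have h0 : ∀ x, cplx x 0 = rotInv x 0 := fun x => by simp [cplx, rotInv]
  have h1 : ∀ x, cplx x 1 = rotInv x 1 := fun x => by simp [cplx, rotInv]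
  have hm' : (m 2 : ℤ) - m 3 + 2 * m 4 - 2 * m 5 = 0 := by
    simp [Fin.sum_univ_six, wt] at hm
    linarith
  rcases le_total (m 5) (m 4) with h | h
  · obtain ⟨d, hd⟩ := Nat.exists_eq_add_of_le h
    have h3 : m 3 = m 2 + 2 * d := by omega
    refine ⟨X 0 ^ m 0 * X 1 ^ m 1 * X 2 ^ m 2 * X 3 ^ m 5 * (X 4 + X 5 * C Complex.I) ^ d,
      fun x => ?_⟩
    simp only [Fin.prod_univ_six, map_mul, map_pow, map_add, eval_X, eval_C]
    rw [← hz, ← hw, ← hzw, ← h0, ← h1, h3, hd]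
    ring
  · obtain ⟨d, hd⟩ := Nat.exists_eq_add_of_le h
    have h3 : m 2 = m 3 + 2 * d := by omega
    refine ⟨X 0 ^ m 0 * X 1 ^ m 1 * X 2 ^ m 3 * X 3 ^ m 4 * (X 4 - X 5 * C Complex.I) ^ d,
      fun x => ?_⟩
    simp only [Fin.prod_univ_six, map_mul, map_pow, map_sub, eval_X, eval_C]
    rw [← hz, ← hw, ← hzw', ← h0, ← h1, h3, hd]
    ring

theorem exists_re_im {σ : Type*} (f : MvPolynomial σ ℂ) :
    ∃ a b : MvPolynomial σ ℝ, ∀ x : σ → ℝ, eval (fun i => ((x i : ℝ) : ℂ)) f =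
      ((eval x a : ℝ) : ℂ) + ((eval x b : ℝ) : ℂ) * Complex.I := by
  induction f using MvPolynomial.induction_on with
  | C c => exact ⟨C c.re, C c.im, fun x => by simp⟩
  | add p q hp hq =>
    obtain ⟨a, b, h⟩ := hp
    obtain ⟨a', b', h'⟩ := hq
    exact ⟨a + a', b + b', fun x => by simp [h, h']; ring⟩
  | mul_X p i hp =>
    obtain ⟨a, b, h⟩ := hp
    exact ⟨a * X i, b * X i, fun x => by simp [h]; ring⟩

/-- The rotation invariants `rotInv` generate all polynomials that are invariant under the
rotations about the third axis. -/
theorem exists_eval_rotInv {J : SymPoly} (hJ : ∀ γ x, eval (rotCoords γ x) J = eval x J) :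
    ∃ f : MvPolynomial (Fin 6) ℝ, ∀ x, eval x J = eval (rotInv x) f := by
  obtain ⟨p, hp⟩ := exists_eval_cplx J
  have hmon : ∀ m : Fin 6 →₀ ℕ, ∃ f : MvPolynomial (Fin 6) ℂ, ∑ i, wt i * m i = 0 →
      ∀ x, ∏ i, cplx x i ^ m i = eval (fun i => ((rotInv x i : ℝ) : ℂ)) f := by
    intro m
    by_cases h : ∑ i, wt i * m i = 0
    · obtain ⟨f, hf⟩ := exists_eval_rotInv_monomial m h
      exact ⟨f, fun _ => hf⟩
    · exact ⟨0, fun h' => absurd h' h⟩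
  choose f hf using hmon
  obtain ⟨a, b, hab⟩ := exists_re_im (∑ m ∈ p.support with ∑ i, wt i * m i = 0,
    C (p.coeff m) * f m)
  refine ⟨a, fun x => ?_⟩
  have h1 : ((eval x J : ℝ) : ℂ) =
      ((eval (rotInv x) a : ℝ) : ℂ) + ((eval (rotInv x) b : ℝ) : ℂ) * Complex.I := by
    rw [eval_eq_sum_weight_zero hJ hp x, ← hab, map_sum]
    refine Finset.sum_congr rfl fun m hm => ?_
    rw [map_mul, eval_C, hf m (Finset.mem_filter.1 hm).2]
  simpa using congrArg Complex.re h1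

/-- Since `(Im (z̄² w))² = |z|⁴ |w|² - (Re (z̄² w))²`, a polynomial in the rotation invariants has
degree at most one in `Im (z̄² w)`. -/
theorem exists_linear_in_im (f : MvPolynomial (Fin 6) ℝ) :
    ∃ a b : MvPolynomial (Fin 5) ℝ, ∀ x, eval (rotInv x) f =
      eval (fun i => rotInv x i.castSucc) a +
        rotInv x 5 * eval (fun i => rotInv x i.castSucc) b := by
  induction f using MvPolynomial.induction_on with
  | C c => exact ⟨C c, 0, fun x => by simp⟩
  | add p q hp hq =>
    obtain ⟨a, b, h⟩ := hp
    obtain ⟨a', b', h'⟩ := hq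
    exact ⟨a + a', b + b', fun x => by simp [h, h']; ring⟩
  | mul_X p i hp =>
    obtain ⟨a, b, h⟩ := hp
    cases i using Fin.lastCases with
    | cast i => exact ⟨a * X i, b * X i, fun x => by simp [h]; ring⟩
    | last =>
      refine ⟨b * (X 2 ^ 2 * X 3 - X 4 ^ 2), a, fun x => ?_⟩
      have hrel : rotInv x 5 ^ 2 = rotInv x 2 ^ 2 * rotInv x 3 - rotInv x 4 ^ 2 := by
        simp [rotInv]
        ring
      have h5 : (Fin.last 5 : Fin 6) = 5 := rfl
      have h2 : (Fin.castSucc 2 : Fin 6) = 2 := rfl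
      have h3 : (Fin.castSucc 3 : Fin 6) = 3 := rfl
      have h4 : (Fin.castSucc 4 : Fin 6) = 4 := rfl
      simp only [map_mul, map_sub, map_pow, eval_X, h, h5, h2, h3, h4]
      linear_combination (eval (fun i : Fin 5 => rotInv x i.castSucc) b) * hrel

/-- The action on coordinates of the half-turn about the first axis. -/
def flipCoords (x : Fin 6 → ℝ) : Fin 6 → ℝ := ![x 0, x 1, x 2, x 3, -x 4, -x 5]

/-- A polynomial invariant under the rotations about the third axis and the half-turn about the
first one is a polynomial in the rotation invariants other than `Im (z̄² w)`. -/
theorem exists_eval_rotInv_of_flip {J : SymPoly}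
    (hJ : ∀ γ x, eval (rotCoords γ x) J = eval x J)
    (hflip : ∀ x, eval (flipCoords x) J = eval x J) :
    ∃ f : MvPolynomial (Fin 5) ℝ, ∀ x, eval x J = eval (fun i => rotInv x i.castSucc) f := by
  obtain ⟨f, hf⟩ := exists_eval_rotInv hJ
  obtain ⟨a, b, hab⟩ := exists_linear_in_im f
  refine ⟨a, fun x => ?_⟩
  have h1 : (fun i : Fin 5 => rotInv (flipCoords x) i.castSucc) =
      fun i : Fin 5 => rotInv x i.castSucc := by
    funext i
    fin_cases i <;> simp [rotInv, flipCoords]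
  have h2 : rotInv (flipCoords x) 5 = -rotInv x 5 := by
    simp [rotInv, flipCoords]
    ring
  have h3 := hflip x
  rw [hf, hf, hab, hab, h1, h2] at h3
  rw [hf, hab]
  linarith

/-! ### The listed invariants in the standard frame -/

/-- The third standard basis vector. -/
def e3 : Fin 3 → ℝ := ![0, 0, 1]

theorem valC_std (x : Fin 6 → ℝ) : valC (permContract e3) (symOf x) =
    ![rotInv x 0 + rotInv x 1, -rotInv x 0,
      rotInv x 1 ^ 2 + rotInv x 0 ^ 2 / 2 + rotInv x 3 / 2 + 2 * rotInv x 2,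
      -(rotInv x 0 ^ 2 / 2 + rotInv x 3 / 2 + rotInv x 2),
      rotInv x 1 ^ 3 + 3 * rotInv x 1 * rotInv x 2 + rotInv x 0 ^ 3 / 4 +
        3 / 4 * rotInv x 0 * rotInv x 3 + 3 / 2 * (rotInv x 0 * rotInv x 2 + rotInv x 4),
      rotInv x 5 / 2] := by
  funext k
  fin_cases k <;>
    simp [valC, e3, permContract, symOf, rotInv, pow_succ, Matrix.trace_fin_three] <;> ring

theorem valD_std (x : Fin 6 → ℝ) : valD (dyad e3) (symOf x) =
    ![rotInv x 0 + rotInv x 1, rotInv x 1,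
      rotInv x 1 ^ 2 + rotInv x 0 ^ 2 / 2 + rotInv x 3 / 2 + 2 * rotInv x 2,
      rotInv x 1 ^ 2 + rotInv x 2,
      rotInv x 1 ^ 3 + 3 * rotInv x 1 * rotInv x 2 + rotInv x 0 ^ 3 / 4 +
        3 / 4 * rotInv x 0 * rotInv x 3 +
        3 / 2 * (rotInv x 0 * rotInv x 2 + rotInv x 4)] := by
  have h : dyad e3 = !![0, 0, 0; 0, 0, 0; 0, 0, 1] := by
    ext i j
    fin_cases i <;> fin_cases j <;> simp [dyad, e3, Matrix.vecMulVec_apply]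
  funext k
  fin_cases k <;>
    simp [valD, h, symOf, rotInv, pow_succ, Matrix.trace_fin_three] <;> ring

/-- The rotation invariants are polynomials in the values `valC`. -/
theorem exists_valC_of_rotInv (f : MvPolynomial (Fin 6) ℝ) : ∃ g : MvPolynomial (Fin 6) ℝ,
    ∀ x, eval (rotInv x) f = eval (valC (permContract e3) (symOf x)) g := by
  let t : MvPolynomial (Fin 6) ℝ := X 0 + X 1
  let r : MvPolynomial (Fin 6) ℝ := X 2 + X 3 - t ^ 2
  let w : MvPolynomial (Fin 6) ℝ := -2 * (X 3 + r) - X 1 ^ 2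
  let h : Fin 6 → MvPolynomial (Fin 6) ℝ := ![-X 1, t, r, w,
    C (2 / 3) * (X 4 - t ^ 3 - 3 * t * r + C (1 / 4) * X 1 ^ 3 + C (3 / 4) * X 1 * w) + X 1 * r,
    2 * X 5]
  refine ⟨aeval h f, fun x => ?_⟩
  rw [eval_aeval]
  congr 2
  funext i
  rw [valC_std]
  fin_cases i <;> simp [h, w, r, t] <;> ring

/-- The rotation invariants other than `Im (z̄² w)` are polynomials in the values `valD`. -/
theorem exists_valD_of_rotInv (f : MvPolynomial (Fin 5) ℝ) : ∃ g : MvPolynomial (Fin 5) ℝ,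
    ∀ x, eval (fun i => rotInv x i.castSucc) f = eval (valD (dyad e3) (symOf x)) g := by
  let t : MvPolynomial (Fin 5) ℝ := X 1
  let s : MvPolynomial (Fin 5) ℝ := X 0 - X 1
  let r : MvPolynomial (Fin 5) ℝ := X 3 - t ^ 2
  let w : MvPolynomial (Fin 5) ℝ := 2 * (X 2 - t ^ 2 - 2 * r) - s ^ 2
  let h : Fin 5 → MvPolynomial (Fin 5) ℝ := ![s, t, r, w,
    C (2 / 3) * (X 4 - t ^ 3 - 3 * t * r - C (1 / 4) * s ^ 3 - C (3 / 4) * s * w) - s * r]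
  refine ⟨aeval h f, fun x => ?_⟩
  rw [eval_aeval]
  congr 2
  funext i
  rw [valD_std]
  fin_cases i <;> simp [h, w, s, r, t] <;> ring

/-- For each of the six invariants of `C_∞`, two tensors at which only that one differs. -/
theorem exists_valC_separated (k : Fin 6) : ∃ x y : Fin 6 → ℝ,
    (∀ j, j ≠ k → valC (permContract e3) (symOf x) j = valC (permContract e3) (symOf y) j) ∧
      valC (permContract e3) (symOf x) k ≠ valC (permContract e3) (symOf y) k := by
  simp only [valC_std]
  -- The `k`-th rows of the two tables form the pair for the `k`-th invariant.
  refine ⟨(![![-4, 4, 3, 0, 3, 0],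
      ![0, 0, 0, -1, 0, 0],
      ![0, 0, 0, 0, 0, -1],
      ![0, 0, 0, -1, 0, 0],
      ![-1, 0, 0, -1, 0, 0],
      ![0, 0, 0, -1, 0, -1]] : Fin 6 → Fin 6 → ℝ) k,
    (![![4, -4, -3, 0, 3, 0],
      ![-1, 0, 1, 0, 0, 0],
      ![0, 0, 0, -1, -1, 0],
      ![0, 0, 0, 0, 0, -1],
      ![-1, 0, 0, 0, -1, 0],
      ![0, 0, 0, -1, 0, 1]] : Fin 6 → Fin 6 → ℝ) k, fun j hj => ?_, ?_⟩
  · fin_cases k <;> fin_cases j <;> simp [rotInv] at hj ⊢ <;> norm_num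
  · fin_cases k <;> simp [rotInv] <;> norm_num

/-- For each of the five invariants of `C_∞v`, two tensors at which only that one differs. -/
theorem exists_valD_separated (k : Fin 5) : ∃ x y : Fin 6 → ℝ,
    (∀ j, j ≠ k → valD (dyad e3) (symOf x) j = valD (dyad e3) (symOf y) j) ∧
      valD (dyad e3) (symOf x) k ≠ valD (dyad e3) (symOf y) k := by
  simp only [valD_std]
  -- The `k`-th rows of the two tables form the pair for the `k`-th invariant.
  refine ⟨(![![-1, 4, 0, 1, 5, 0],
      ![0, 0, 0, -1, 0, 0],
      ![0, 0, 0, 0, 0, 0],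
      ![0, 0, 0, -1, 0, 0],
      ![-1, 0, 0, -1, 0, 0]] : Fin 5 → Fin 6 → ℝ) k,
    (![![1, -4, 0, 1, 5, 0],
      ![-1, 0, 1, 0, 0, 0],
      ![0, 0, 0, 0, 0, -1],
      ![0, 0, 0, 0, 0, -1],
      ![-1, 0, 0, 0, -1, 0]] : Fin 5 → Fin 6 → ℝ) k, fun j hj => ?_, ?_⟩
  · fin_cases k <;> fin_cases j <;> simp [rotInv] at hj ⊢ <;> norm_num
  · fin_cases k <;> simp [rotInv] <;> norm_num

/-! ### Structural tensors and orthonormal frames -/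

theorem conj_dyad (Q : Matrix (Fin 3) (Fin 3) ℝ) (a : Fin 3 → ℝ) :
    Q * dyad a * Qᵀ = dyad (Q *ᵥ a) := by
  rw [dyad, dyad, Matrix.mul_vecMulVec, Matrix.vecMulVec_mul, Matrix.vecMul_transpose]

theorem dyad_neg (a : Fin 3 → ℝ) : dyad (-a) = dyad a := by
  simp [dyad]

/-- The orthogonal matrix with columns `a₁, a₃ × a₁, a₃`. -/
def frame (a₁ a₃ : Fin 3 → ℝ) : Matrix (Fin 3) (Fin 3) ℝ :=
  (Matrix.of ![a₁, crossProduct a₃ a₁, a₃])ᵀ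

section Frame

variable {a₁ a₃ : Fin 3 → ℝ}

theorem frame_transpose_mul_self (h₁ : a₁ ⬝ᵥ a₁ = 1) (h₃ : a₃ ⬝ᵥ a₃ = 1) (h₁₃ : a₁ ⬝ᵥ a₃ = 0) :
    (frame a₁ a₃)ᵀ * frame a₁ a₃ = 1 := by
  have h : ∀ i j, ((frame a₁ a₃)ᵀ * frame a₁ a₃) i j =
      (![a₁, crossProduct a₃ a₁, a₃] i) ⬝ᵥ (![a₁, crossProduct a₃ a₁, a₃] j) := fun i j => rfl
  have h₃₁ : a₃ ⬝ᵥ a₁ = 0 := by rw [dotProduct_comm, h₁₃]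
  ext i j
  rw [h]
  fin_cases i <;> fin_cases j <;>
    simp [h₁, h₃, h₁₃, h₃₁, cross_dot_cross, dotProduct_comm (crossProduct a₃ a₁)]

theorem frame_mul_transpose_self (h₁ : a₁ ⬝ᵥ a₁ = 1) (h₃ : a₃ ⬝ᵥ a₃ = 1) (h₁₃ : a₁ ⬝ᵥ a₃ = 0) :
    frame a₁ a₃ * (frame a₁ a₃)ᵀ = 1 :=
  mul_eq_one_comm.1 (frame_transpose_mul_self h₁ h₃ h₁₃)

theorem frame_mulVec_e3 : frame a₁ a₃ *ᵥ e3 = a₃ := by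
  ext i
  simp [frame, e3, Matrix.mulVec, dotProduct, Fin.sum_univ_three]

theorem frame_conj_dyad : frame a₁ a₃ * dyad e3 * (frame a₁ a₃)ᵀ = dyad a₃ := by
  rw [conj_dyad, frame_mulVec_e3]

/-- In the frame `a₁, a₃ × a₁, a₃` the tensor `E ⬝ a₃` has its standard form. -/
theorem frame_conj_permContract (h₁ : a₁ ⬝ᵥ a₁ = 1) (h₁₃ : a₁ ⬝ᵥ a₃ = 0) :
    frame a₁ a₃ * permContract e3 * (frame a₁ a₃)ᵀ = permContract a₃ := by
  have h1 : a₁ 0 * a₁ 0 + a₁ 1 * a₁ 1 + a₁ 2 * a₁ 2 = 1 := by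
    simpa [dotProduct, Fin.sum_univ_three] using h₁
  have h2 : a₁ 0 * a₃ 0 + a₁ 1 * a₃ 1 + a₁ 2 * a₃ 2 = 0 := by
    simpa [dotProduct, Fin.sum_univ_three] using h₁₃
  ext i j
  fin_cases i <;> fin_cases j <;>
    simp [frame, e3, permContract, Matrix.mul_apply, Fin.sum_univ_three, cross_apply]
  · ring
  · linear_combination a₃ 2 * h1 - a₁ 2 * h2
  · linear_combination -a₃ 1 * h1 + a₁ 1 * h2
  · linear_combination -a₃ 2 * h1 + a₁ 2 * h2
  · ring
  · linear_combination a₃ 0 * h1 - a₁ 0 * h2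
  · linear_combination a₃ 1 * h1 - a₁ 1 * h2
  · linear_combination -a₃ 0 * h1 + a₁ 0 * h2
  · ring

theorem frame_conj_rot (h₁ : a₁ ⬝ᵥ a₁ = 1) (h₃ : a₃ ⬝ᵥ a₃ = 1) (h₁₃ : a₁ ⬝ᵥ a₃ = 0) (γ : ℝ) :
    frame a₁ a₃ * rot e3 γ * (frame a₁ a₃)ᵀ = rot a₃ γ := by
  simp only [rot, Matrix.mul_sub, Matrix.mul_add, Matrix.sub_mul, Matrix.add_mul,
    Matrix.mul_smul, Matrix.smul_mul, frame_conj_dyad, frame_conj_permContract h₁ h₁₃,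
    Matrix.mul_one, frame_mul_transpose_self h₁ h₃ h₁₃]

theorem rot_pi (p : Fin 3 → ℝ) : rot p Real.pi = (2 : ℝ) • dyad p - 1 := by
  rw [rot, Real.cos_pi, Real.sin_pi, zero_smul, sub_zero, neg_one_smul, sub_neg_eq_add,
    one_add_one_eq_two]
  abel

theorem frame_conj_rot_pi (h₁ : a₁ ⬝ᵥ a₁ = 1) (h₃ : a₃ ⬝ᵥ a₃ = 1) (h₁₃ : a₁ ⬝ᵥ a₃ = 0) :
    frame a₁ a₃ * rot ![1, 0, 0] Real.pi * (frame a₁ a₃)ᵀ = rot a₁ Real.pi := by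
  have h : frame a₁ a₃ *ᵥ ![1, 0, 0] = a₁ := by
    ext i
    simp [frame, Matrix.mulVec, dotProduct, Fin.sum_univ_three]
  rw [rot_pi, rot_pi, Matrix.mul_sub, Matrix.sub_mul, Matrix.mul_smul, Matrix.smul_mul,
    conj_dyad, h, Matrix.mul_one, frame_mul_transpose_self h₁ h₃ h₁₃]

end Frame

theorem rot_mulVec_self {p : Fin 3 → ℝ} (hp : p ⬝ᵥ p = 1) (γ : ℝ) : rot p γ *ᵥ p = p := by
  rw [rot_mulVec, hp, cross_self, smul_zero, add_zero, ← add_smul]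
  simp

theorem rot_mul_permContract (p : Fin 3 → ℝ) (γ : ℝ) :
    rot p γ * permContract p = permContract p * rot p γ := by
  have h1 : dyad p * permContract p = 0 := by
    rw [dyad, Matrix.vecMulVec_mul]
    have h : p ᵥ* permContract p = 0 := by
      ext i
      fin_cases i <;>
        simp [permContract, Matrix.vecMul, dotProduct, Fin.sum_univ_three] <;> ring
    rw [h, Matrix.vecMulVec_zero]
  have h2 : permContract p * dyad p = 0 := by
    rw [dyad, Matrix.mul_vecMulVec, permContract_mulVec, cross_self, Matrix.zero_vecMulVec]
  simp [rot, Matrix.mul_sub, Matrix.mul_add, Matrix.sub_mul, Matrix.add_mul, h1, h2]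

theorem coords_rot_conj (γ : ℝ) (x : Fin 6 → ℝ) :
    coords (rot e3 γ * symOf x * (rot e3 γ)ᵀ) = rotCoords γ x := by
  have h : rot e3 γ = !![Real.cos γ, -Real.sin γ, 0; Real.sin γ, Real.cos γ, 0; 0, 0, 1] := by
    ext i j
    fin_cases i <;> fin_cases j <;>
      simp [rot, dyad, e3, permContract]
  have hT : (rot e3 γ)ᵀ =
      !![Real.cos γ, Real.sin γ, 0; -Real.sin γ, Real.cos γ, 0; 0, 0, 1] := by
    rw [h]
    ext i j
    fin_cases i <;> fin_cases j <;> rfl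
  rw [hT, h]
  funext i
  fin_cases i <;> simp [coords, symOf, rotCoords] <;> ring

theorem coords_rot_pi_conj (x : Fin 6 → ℝ) :
    coords (rot ![1, 0, 0] Real.pi * symOf x * (rot ![1, 0, 0] Real.pi)ᵀ) = flipCoords x := by
  have h : rot ![1, 0, 0] Real.pi = !![1, 0, 0; 0, -1, 0; 0, 0, -1] := by
    have h2 : (2 : ℝ) - 1 = 1 := by norm_num
    rw [rot_pi]
    ext i j
    fin_cases i <;> fin_cases j <;> simp [dyad, h2]
  have hT : (rot ![1, 0, 0] Real.pi)ᵀ = !![1, 0, 0; 0, -1, 0; 0, 0, -1] := by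
    rw [h]
    ext i j
    fin_cases i <;> fin_cases j <;> rfl
  rw [hT, h]
  funext i
  fin_cases i <;> simp [coords, symOf, flipCoords]

/-! ### Invariance under the groups with a distinguished axis -/

section Invariance

variable {a₁ a₃ : Fin 3 → ℝ}

theorem CinfH_le_tensorStabilizer (a₃ : Fin 3 → ℝ) :
    CinfH a₃ ≤ tensorStabilizer (permContract a₃) := by
  refine (Subgroup.closure_le _).2 ?_
  rintro Q (⟨γ, -, hQ⟩ | hQ)
  · have h := O3.mul_transpose_self Q
    change Q.1 * permContract a₃ * Q.1ᵀ = permContract a₃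
    rw [hQ] at h ⊢
    rw [rot_mul_permContract, Matrix.mul_assoc, h, Matrix.mul_one]
  · change Q.1 = -1 at hQ
    change Q.1 * permContract a₃ * Q.1ᵀ = permContract a₃
    simp [hQ]

theorem Cinf_le_CinfH (a₃ : Fin 3 → ℝ) : Cinf a₃ ≤ CinfH a₃ :=
  Subgroup.closure_mono Set.subset_union_left

theorem axialRotations_subset_tensorStabilizer (h₃ : a₃ ⬝ᵥ a₃ = 1) :
    axialRotations a₃ ⊆ tensorStabilizer (dyad a₃) := by
  rintro Q ⟨γ, -, hQ⟩
  change Q.1 * dyad a₃ * Q.1ᵀ = dyad a₃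
  rw [conj_dyad, hQ, rot_mulVec_self h₃]

theorem rot_pi_conj_dyad (h₁₃ : a₁ ⬝ᵥ a₃ = 0) :
    rot a₁ Real.pi * dyad a₃ * (rot a₁ Real.pi)ᵀ = dyad a₃ := by
  have h : rot a₁ Real.pi *ᵥ a₃ = -a₃ := by
    rw [rot_mulVec, h₁₃, Real.cos_pi, Real.sin_pi]
    simp
  rw [conj_dyad, h, dyad_neg]

theorem CinfV_le_tensorStabilizer (h₃ : a₃ ⬝ᵥ a₃ = 1) (h₁₃ : a₁ ⬝ᵥ a₃ = 0) :
    CinfV a₁ a₃ ≤ tensorStabilizer (dyad a₃) := by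
  refine (Subgroup.closure_le _).2
    (Set.union_subset (axialRotations_subset_tensorStabilizer h₃) fun Q hQ => ?_)
  change Q.1 = -rot a₁ Real.pi at hQ
  change Q.1 * dyad a₃ * Q.1ᵀ = dyad a₃
  rw [hQ, Matrix.transpose_neg, Matrix.neg_mul, neg_mul_neg, rot_pi_conj_dyad h₁₃]

theorem DinfH_le_tensorStabilizer (h₃ : a₃ ⬝ᵥ a₃ = 1) (h₁₃ : a₁ ⬝ᵥ a₃ = 0) :
    DinfH a₁ a₃ ≤ tensorStabilizer (dyad a₃) := by
  refine (Subgroup.closure_le _).2 (Set.union_subset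
    (Set.union_subset (axialRotations_subset_tensorStabilizer h₃) fun Q hQ => ?_) fun Q hQ => ?_)
  · change Q.1 = -1 at hQ
    change Q.1 * dyad a₃ * Q.1ᵀ = dyad a₃
    simp [hQ]
  · change Q.1 = rot a₁ Real.pi at hQ
    change Q.1 * dyad a₃ * Q.1ᵀ = dyad a₃
    rw [hQ, rot_pi_conj_dyad h₁₃]

end Invariance

/-! ### Completeness for the groups with a distinguished axis -/

/-- The polynomial `S ↦ J (P S Pᵀ)`. -/
noncomputable def conjPoly (P : Matrix (Fin 3) (Fin 3) ℝ) (J : SymPoly) : SymPoly :=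
  aeval (coords (const P * genC * (const P)ᵀ)) J

theorem eval_conjPoly (P : Matrix (Fin 3) (Fin 3) ℝ) (J : SymPoly)
    {S : Matrix (Fin 3) (Fin 3) ℝ} (hS : S.IsSymm) :
    eval (coords S) (conjPoly P J) = eval (coords (P * S * Pᵀ)) J := by
  have h : ∀ (x : Fin 6 → ℝ) (M : Matrix (Fin 3) (Fin 3) SymPoly),
      (fun i => eval x (coords M i)) = coords (M.map (eval x)) := by
    intro x M
    funext i
    fin_cases i <;> rfl
  rw [conjPoly, eval_aeval, h, Matrix.map_mul, Matrix.map_mul, Matrix.transpose_map,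
    const_map_eval, genC_map_eval hS]

section Completeness

variable {a₁ a₃ : Fin 3 → ℝ} {G : Subgroup O3} {J : SymPoly}

theorem eval_rot_conj (h₃ : a₃ ⬝ᵥ a₃ = 1) (hG : Cinf a₃ ≤ G) (hJ : J ∈ invariantRing G) (γ : ℝ)
    {S : Matrix (Fin 3) (Fin 3) ℝ} (hS : S.IsSymm) :
    eval (coords (rot a₃ γ * S * (rot a₃ γ)ᵀ)) J = eval (coords S) J := by
  have hπ : (0 : ℝ) < 2 * Real.pi := by positivity
  -- Every angle is reduced to `[0, 2π)`, where the generators of the group live.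
  obtain ⟨δ, hδ, hrot⟩ : ∃ δ ∈ Set.Ico (0 : ℝ) (2 * Real.pi), rot a₃ γ = rot a₃ δ := by
    refine ⟨toIcoMod hπ 0 γ, by simpa using toIcoMod_mem_Ico hπ 0 γ, ?_⟩
    have h : γ = toIcoMod hπ 0 γ + toIcoDiv hπ 0 γ * (2 * Real.pi) := by
      rw [← zsmul_eq_mul, toIcoMod_add_toIcoDiv_zsmul]
    have hc : Real.cos γ = Real.cos (toIcoMod hπ 0 γ) := by
      conv_lhs => rw [h, Real.cos_add_int_mul_two_pi]
    have hs : Real.sin γ = Real.sin (toIcoMod hπ 0 γ) := by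
      conv_lhs => rw [h, Real.sin_add_int_mul_two_pi]
    rw [rot, rot, hc, hs]
  rw [hrot]
  exact hJ ⟨rot a₃ δ, rot_mem_orthogonalGroup h₃ δ⟩
    (hG (Subgroup.subset_closure ⟨δ, hδ, rfl⟩)) S hS

theorem eval_conjPoly_frame_rotCoords (h₁ : a₁ ⬝ᵥ a₁ = 1) (h₃ : a₃ ⬝ᵥ a₃ = 1)
    (h₁₃ : a₁ ⬝ᵥ a₃ = 0) (hG : Cinf a₃ ≤ G) (hJ : J ∈ invariantRing G) (γ : ℝ)
    (x : Fin 6 → ℝ) :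
    eval (rotCoords γ x) (conjPoly (frame a₁ a₃) J) = eval x (conjPoly (frame a₁ a₃) J) := by
  have hP := frame_transpose_mul_self h₁ h₃ h₁₃
  have hx := isSymm_symOf x
  conv_rhs => rw [← coords_symOf x]
  rw [← coords_rot_conj, eval_conjPoly _ _ (isSymm_conj _ hx), eval_conjPoly _ _ hx,
    ← eval_rot_conj h₃ hG hJ γ (isSymm_conj _ hx), ← frame_conj_rot h₁ h₃ h₁₃,
    ← conj_mul_conj hP, ← conj_mul_conj hP]
  simp only [Matrix.transpose_mul, Matrix.transpose_transpose, Matrix.mul_assoc]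

theorem exists_conj_frame (h₁ : a₁ ⬝ᵥ a₁ = 1) (h₃ : a₃ ⬝ᵥ a₃ = 1) (h₁₃ : a₁ ⬝ᵥ a₃ = 0)
    {S : Matrix (Fin 3) (Fin 3) ℝ} (hS : S.IsSymm) :
    ∃ T : Matrix (Fin 3) (Fin 3) ℝ, T.IsSymm ∧ frame a₁ a₃ * T * (frame a₁ a₃)ᵀ = S := by
  have hP := frame_mul_transpose_self h₁ h₃ h₁₃
  refine ⟨(frame a₁ a₃)ᵀ * S * (frame a₁ a₃)ᵀᵀ, isSymm_conj _ hS, ?_⟩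
  rw [Matrix.transpose_transpose]
  calc frame a₁ a₃ * ((frame a₁ a₃)ᵀ * S * frame a₁ a₃) * (frame a₁ a₃)ᵀ
      = (frame a₁ a₃ * (frame a₁ a₃)ᵀ) * S * (frame a₁ a₃ * (frame a₁ a₃)ᵀ) := by
        simp only [Matrix.mul_assoc]
    _ = S := by rw [hP, Matrix.one_mul, Matrix.mul_one]

/-- The six invariants of `C_∞` are complete for every group containing `C_∞`. -/
theorem exists_eval_valC (h₁ : a₁ ⬝ᵥ a₁ = 1) (h₃ : a₃ ⬝ᵥ a₃ = 1) (h₁₃ : a₁ ⬝ᵥ a₃ = 0)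
    (hG : Cinf a₃ ≤ G) (hJ : J ∈ invariantRing G) :
    ∃ f : MvPolynomial (Fin 6) ℝ, ∀ S : Matrix (Fin 3) (Fin 3) ℝ, S.IsSymm →
      eval (coords S) J = eval (valC (permContract a₃) S) f := by
  obtain ⟨f, hf⟩ := exists_eval_rotInv (eval_conjPoly_frame_rotCoords h₁ h₃ h₁₃ hG hJ)
  obtain ⟨g, hg⟩ := exists_valC_of_rotInv f
  refine ⟨g, fun S hS => ?_⟩
  obtain ⟨T, hT, rfl⟩ := exists_conj_frame h₁ h₃ h₁₃ hS
  rw [← eval_conjPoly _ _ hT, hf, hg, symOf_coords hT, ← frame_conj_permContract h₁ h₁₃,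
    valC_conj (frame_transpose_mul_self h₁ h₃ h₁₃)]

/-- The five invariants of `C_∞v` are complete for every group containing `C_∞` whose invariants
are unchanged by the half-turn about `a₁`. -/
theorem exists_eval_valD (h₁ : a₁ ⬝ᵥ a₁ = 1) (h₃ : a₃ ⬝ᵥ a₃ = 1) (h₁₃ : a₁ ⬝ᵥ a₃ = 0)
    (hG : Cinf a₃ ≤ G) (hJ : J ∈ invariantRing G)
    (hflip : ∀ S : Matrix (Fin 3) (Fin 3) ℝ, S.IsSymm →
      eval (coords (rot a₁ Real.pi * S * (rot a₁ Real.pi)ᵀ)) J = eval (coords S) J) :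
    ∃ f : MvPolynomial (Fin 5) ℝ, ∀ S : Matrix (Fin 3) (Fin 3) ℝ, S.IsSymm →
      eval (coords S) J = eval (valD (dyad a₃) S) f := by
  have hP := frame_transpose_mul_self h₁ h₃ h₁₃
  obtain ⟨f, hf⟩ := exists_eval_rotInv_of_flip
    (eval_conjPoly_frame_rotCoords h₁ h₃ h₁₃ hG hJ) fun x => by
      have hx := isSymm_symOf x
      conv_rhs => rw [← coords_symOf x]
      rw [← coords_rot_pi_conj, eval_conjPoly _ _ (isSymm_conj _ hx), eval_conjPoly _ _ hx,
        ← hflip _ (isSymm_conj _ hx), ← frame_conj_rot_pi h₁ h₃ h₁₃,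
        ← conj_mul_conj hP, ← conj_mul_conj hP]
      simp only [Matrix.transpose_mul, Matrix.transpose_transpose, Matrix.mul_assoc]
  obtain ⟨g, hg⟩ := exists_valD_of_rotInv f
  refine ⟨g, fun S hS => ?_⟩
  obtain ⟨T, hT, rfl⟩ := exists_conj_frame h₁ h₃ h₁₃ hS
  rw [← eval_conjPoly _ _ hT, hf, hg, symOf_coords hT, ← frame_conj_dyad (a₁ := a₁) (a₃ := a₃),
    valD_conj hP]

theorem isIrreducibleIntegrityBasis_basisCinf (h₁ : a₁ ⬝ᵥ a₁ = 1) (h₃ : a₃ ⬝ᵥ a₃ = 1)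
    (h₁₃ : a₁ ⬝ᵥ a₃ = 0) (hG : Cinf a₃ ≤ G) (hG' : G ≤ tensorStabilizer (permContract a₃)) :
    IsIrreducibleIntegrityBasis G (basisCinf a₃) := by
  refine isIrreducibleIntegrityBasis_of_values (valC (permContract a₃))
    (fun S hS k => eval_basisCinf a₃ hS k) (basisCinf_homogeneous a₃) (fun Q hQ S _ => ?_)
    (fun J hJ => exists_eval_valC h₁ h₃ h₁₃ hG hJ) fun k => ?_
  · have h := valC_conj (O3.transpose_mul_self Q) (permContract a₃) S
    rwa [mem_tensorStabilizer.1 (hG' hQ)] at h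
  · obtain ⟨x, y, hxy⟩ := exists_valC_separated k
    refine ⟨_, _, isSymm_conj (frame a₁ a₃) (isSymm_symOf x),
      isSymm_conj (frame a₁ a₃) (isSymm_symOf y), ?_⟩
    simpa only [← frame_conj_permContract h₁ h₁₃,
      valC_conj (frame_transpose_mul_self h₁ h₃ h₁₃)] using hxy

theorem isIrreducibleIntegrityBasis_basisDinf (h₁ : a₁ ⬝ᵥ a₁ = 1) (h₃ : a₃ ⬝ᵥ a₃ = 1)
    (h₁₃ : a₁ ⬝ᵥ a₃ = 0) (hG : Cinf a₃ ≤ G) (hG' : G ≤ tensorStabilizer (dyad a₃))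
    (hflip : ∀ J ∈ invariantRing G, ∀ S : Matrix (Fin 3) (Fin 3) ℝ, S.IsSymm →
      eval (coords (rot a₁ Real.pi * S * (rot a₁ Real.pi)ᵀ)) J = eval (coords S) J) :
    IsIrreducibleIntegrityBasis G (basisDinf a₃) := by
  refine isIrreducibleIntegrityBasis_of_values (valD (dyad a₃))
    (fun S hS k => eval_basisDinf a₃ hS k) (basisDinf_homogeneous a₃) (fun Q hQ S _ => ?_)
    (fun J hJ => exists_eval_valD h₁ h₃ h₁₃ hG hJ (hflip J hJ)) fun k => ?_
  · have h := valD_conj (O3.transpose_mul_self Q) (dyad a₃) S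
    rwa [mem_tensorStabilizer.1 (hG' hQ)] at h
  · obtain ⟨x, y, hxy⟩ := exists_valD_separated k
    refine ⟨_, _, isSymm_conj (frame a₁ a₃) (isSymm_symOf x),
      isSymm_conj (frame a₁ a₃) (isSymm_symOf y), ?_⟩
    simpa only [← frame_conj_dyad (a₁ := a₁) (a₃ := a₃),
      valD_conj (frame_transpose_mul_self h₁ h₃ h₁₃)] using hxy

end Completeness

/-! ### The full orthogonal group -/

theorem valK_diagonal (d : Fin 3 → ℝ) : valK (Matrix.diagonal d) =
    ![d 0 + d 1 + d 2, d 0 ^ 2 + d 1 ^ 2 + d 2 ^ 2, d 0 ^ 3 + d 1 ^ 3 + d 2 ^ 3] := by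
  funext k
  fin_cases k <;> simp [valK, Matrix.diagonal_pow, Matrix.trace_diagonal, Fin.sum_univ_three]

theorem exists_valK_separated (k : Fin 3) : ∃ d d' : Fin 3 → ℝ,
    (∀ j, j ≠ k → valK (Matrix.diagonal d) j = valK (Matrix.diagonal d') j) ∧
      valK (Matrix.diagonal d) k ≠ valK (Matrix.diagonal d') k := by
  simp only [valK_diagonal]
  -- The `k`-th rows of the two tables form the pair for the `k`-th invariant.
  refine ⟨(![![-10, 3, 3],
      ![0, 0, 0],
      ![-2, 1, 1]] : Fin 3 → Fin 3 → ℝ) k,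
    (![![-9, -6, -1],
      ![-1, 0, 1],
      ![-1, -1, 2]] : Fin 3 → Fin 3 → ℝ) k, fun j hj => ?_, ?_⟩
  · fin_cases k <;> fin_cases j <;> simp at hj ⊢ <;> norm_num
  · fin_cases k <;> simp <;> norm_num

/-- A real symmetric tensor is an orthogonal conjugate of a diagonal one. -/
theorem exists_orthogonal_diagonal {S : Matrix (Fin 3) (Fin 3) ℝ} (hS : S.IsSymm) :
    ∃ (Q : O3) (d : Fin 3 → ℝ), S = Q.1 * Matrix.diagonal d * Q.1ᵀ := by
  have hA : S.IsHermitian := by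
    rw [Matrix.IsHermitian, Matrix.conjTranspose_eq_transpose_of_trivial, hS.eq]
  refine ⟨hA.eigenvectorUnitary, hA.eigenvalues, ?_⟩
  have h := hA.spectral_theorem
  rw [Unitary.conjStarAlgAut_apply] at h
  exact h

/-- Permuting the entries of a diagonal tensor is conjugation by a permutation matrix. -/
theorem exists_orthogonal_perm (σ : Equiv.Perm (Fin 3)) (d : Fin 3 → ℝ) :
    ∃ Q : O3, Matrix.diagonal (d ∘ σ) = Q.1 * Matrix.diagonal d * Q.1ᵀ := by
  let M : Matrix (Fin 3) (Fin 3) ℝ := (1 : Matrix (Fin 3) (Fin 3) ℝ).submatrix σ id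
  have hM : ∀ D : Matrix (Fin 3) (Fin 3) ℝ, M * D * Mᵀ = D.submatrix σ σ := by
    intro D
    ext i j
    simp [M, Matrix.mul_apply, Matrix.one_apply]
  have h1 : M * Mᵀ = 1 := by
    have h := hM 1
    rwa [Matrix.mul_one, Matrix.submatrix_one_equiv] at h
  exact ⟨⟨M, (Matrix.mem_orthogonalGroup_iff _ _).2 h1⟩, by
    rw [hM, Matrix.submatrix_diagonal_equiv]⟩

/-- The elementary symmetric polynomials in three variables are polynomials in the power sums. -/
theorem exists_esymm_eval (i : Fin 3) : ∃ g : MvPolynomial (Fin 3) ℝ, ∀ d : Fin 3 → ℝ,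
    eval d (esymm (Fin 3) ℝ (i + 1)) = eval (valK (Matrix.diagonal d)) g := by
  have h2 : (Finset.univ : Finset (Fin 3)).powersetCard 2 = {{0, 1}, {0, 2}, {1, 2}} := by
    decide
  have h3 : (Finset.univ : Finset (Fin 3)).powersetCard 3 = {{0, 1, 2}} := by
    decide
  fin_cases i
  · exact ⟨X 0, fun d => by simp [valK_diagonal, Fin.sum_univ_three]⟩
  · refine ⟨C (1 / 2) * (X 0 ^ 2 - X 1), fun d => ?_⟩
    have h : eval d (esymm (Fin 3) ℝ 2) = d 0 * d 1 + (d 0 * d 2 + d 1 * d 2) := by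
      rw [esymm, h2, Finset.sum_insert (by decide), Finset.sum_insert (by decide),
        Finset.sum_singleton]
      simp
    change eval d (esymm (Fin 3) ℝ 2) = _
    rw [h]
    simp [valK_diagonal]
    ring
  · refine ⟨C (1 / 6) * X 0 ^ 3 - C (1 / 2) * X 0 * X 1 + C (1 / 3) * X 2, fun d => ?_⟩
    have h : eval d (esymm (Fin 3) ℝ 3) = d 0 * (d 1 * d 2) := by
      rw [esymm, h3, Finset.sum_singleton]
      simp
    change eval d (esymm (Fin 3) ℝ 3) = _
    rw [h]
    simp [valK_diagonal]
    ring

/-- The restriction of an `O(3)`-invariant to diagonal tensors is a symmetric polynomial, hence a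
polynomial in the power sums of the eigenvalues. -/
theorem exists_eval_valK {J : SymPoly} (hJ : J ∈ invariantRing Kh) :
    ∃ f : MvPolynomial (Fin 3) ℝ, ∀ S : Matrix (Fin 3) (Fin 3) ℝ, S.IsSymm →
      eval (coords S) J = eval (valK S) f := by
  let p : MvPolynomial (Fin 3) ℝ := aeval (![X 0, X 1, X 2, 0, 0, 0] : Fin 6 → _) J
  have hp : ∀ d, eval d p = eval (coords (Matrix.diagonal d)) J := by
    intro d
    rw [eval_aeval]
    congr 2
    funext i
    fin_cases i <;> simp [coords]
  have hsymm : p.IsSymmetric := by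
    intro σ
    refine MvPolynomial.funext fun d => ?_
    obtain ⟨Q, hQ⟩ := exists_orthogonal_perm σ d
    rw [eval_rename, hp, hp, hQ]
    exact hJ Q (Subgroup.mem_top Q) _ (Matrix.isSymm_diagonal d)
  obtain ⟨q, hq⟩ := esymmAlgHom_surjective ℝ (σ := Fin 3) (n := 3) (by simp) ⟨p, hsymm⟩
  have hq' : aeval (fun i : Fin 3 => esymm (Fin 3) ℝ (i + 1)) q = p := by
    rw [← esymmAlgHom_apply, hq]
  choose g hg using exists_esymm_eval
  refine ⟨aeval g q, fun S hS => ?_⟩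
  obtain ⟨Q, d, rfl⟩ := exists_orthogonal_diagonal hS
  rw [hJ Q (Subgroup.mem_top Q) _ (Matrix.isSymm_diagonal d), ← hp, ← hq', eval_aeval,
    eval_aeval, valK_conj (O3.transpose_mul_self Q)]
  simp only [hg]

theorem isIrreducibleIntegrityBasis_basisKh : IsIrreducibleIntegrityBasis Kh basisKh := by
  refine isIrreducibleIntegrityBasis_of_values valK (fun S hS k => eval_basisKh hS k)
    basisKh_homogeneous (fun Q _ S _ => valK_conj (O3.transpose_mul_self Q) S)
    (fun J hJ => exists_eval_valK hJ) fun k => ?_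
  obtain ⟨d, d', hd⟩ := exists_valK_separated k
  exact ⟨_, _, Matrix.isSymm_diagonal d, Matrix.isSymm_diagonal d', hd⟩

end IntegrityBases

theorem mainTheorem2 (a₁ a₃ : Fin 3 → ℝ)
    (h₁ : a₁ ⬝ᵥ a₁ = 1) (h₃ : a₃ ⬝ᵥ a₃ = 1) (h₁₃ : a₁ ⬝ᵥ a₃ = 0) :
    IntegrityBases.IsIrreducibleIntegrityBasis (IntegrityBases.Cinf a₃)
      (IntegrityBases.basisCinf a₃) ∧
    IntegrityBases.IsIrreducibleIntegrityBasis (IntegrityBases.CinfH a₃)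
      (IntegrityBases.basisCinf a₃) ∧
    IntegrityBases.IsIrreducibleIntegrityBasis (IntegrityBases.CinfV a₁ a₃)
      (IntegrityBases.basisDinf a₃) ∧
    IntegrityBases.IsIrreducibleIntegrityBasis (IntegrityBases.DinfH a₁ a₃)
      (IntegrityBases.basisDinf a₃) ∧
    IntegrityBases.IsIrreducibleIntegrityBasis IntegrityBases.Kh
      IntegrityBases.basisKh := by
  open IntegrityBases in
  have hrot := rot_mem_orthogonalGroup h₁ Real.pi
  have hneg : -rot a₁ Real.pi ∈ Matrix.orthogonalGroup (Fin 3) ℝ := by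
    simpa [Matrix.mem_orthogonalGroup_iff] using hrot
  refine ⟨?_, ?_, ?_, ?_, isIrreducibleIntegrityBasis_basisKh⟩
  · exact isIrreducibleIntegrityBasis_basisCinf h₁ h₃ h₁₃ le_rfl
      ((Cinf_le_CinfH a₃).trans (CinfH_le_tensorStabilizer a₃))
  · exact isIrreducibleIntegrityBasis_basisCinf h₁ h₃ h₁₃ (Cinf_le_CinfH a₃)
      (CinfH_le_tensorStabilizer a₃)
  · refine isIrreducibleIntegrityBasis_basisDinf h₁ h₃ h₁₃
      (Subgroup.closure_mono Set.subset_union_left) (CinfV_le_tensorStabilizer h₃ h₁₃)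
      fun J hJ S hS => ?_
    -- The generator `-R(a₁, π)` acts on tensors like `R(a₁, π)`.
    have h := hJ ⟨-rot a₁ Real.pi, hneg⟩ (Subgroup.subset_closure (Or.inr rfl)) S hS
    simpa using h
  · refine isIrreducibleIntegrityBasis_basisDinf h₁ h₃ h₁₃
      (Subgroup.closure_mono (Set.subset_union_left.trans Set.subset_union_left))
      (DinfH_le_tensorStabilizer h₃ h₁₃) fun J hJ S hS => ?_
    exact hJ ⟨rot a₁ Real.pi, hrot⟩ (Subgroup.subset_closure (Or.inr rfl)) S hS
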